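/- Let $N$ be a positive integer. For $x\in\mathbb R^N$ let $P_x=|Fx|^2\in\mathbb R^N_{\ge 0}$ (componentwise squared absolute value) be its power spectrum, where $F=(\omega^{kn})_{0\le k,n<N}$, $\omega=e^{2\pi i/N}$, is the discrete Fourier transform matrix; for a linear subspace $W\subset\mathbb R^N$ let $P_W=\{P_x : x\in W\}$. For an ordered basis $\mathbb V=(v_1,\dots,v_N)$ of $\mathbb R^N$ and $S\subset\{1,\dots,N\}$ put $\mathbb L_S(\mathbb V)=\mathrm{span}(v_i : i\in S)$. A property holds for a generic point of an irreducible real variety $X$ if it holds on a non-empty Zariski open subset of $X$; bases of $\mathbb R^N$ are regarded as points of $\mathrm{GL}(N,\mathbb R)\subset\mathbb R^{N\times N}$. For an integer $M\ge 0$ consider the following conditions on $\mathbb V$. - (SR1) For all $S$ with $|S|=M$ and all $x,y\in\mathbb L_S(\mathbb V)$: $P_x=P_y$ if and only if $x=\pm y$. - (SR2) For all distinct $S_1,S_2$ with $|S_1|=|S_2|=M$: $P_{\mathbb L_{S_1}(\mathbb V)}\cap P_{\mathbb L_{S_2}(\mathbb V)}=P_{\mathbb L_{S_1}(\mathbb V)\cap\mathbb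 L_{S_2}(\mathbb V)}$. - (SR1g) For all $S$ with $|S|=M$ and generic $x\in\mathbb L_S(\mathbb V)$: for every $y\in\mathbb L_S(\mathbb V)$, $P_x=P_y$ if and only if $x=\pm y$. - (SR2g) For all distinct $S_1,S_2$ with $|S_1|=|S_2|=M$: $P_{\mathbb L_{S_1}(\mathbb V)}\cap P_{\mathbb L_{S_2}(\mathbb V)}$ is contained in a proper real-algebraic subset of $P_{\mathbb L_{S_1}(\mathbb V)}$, that is, in $P_{\mathbb L_{S_1}(\mathbb V)}\cap Z$ for some real algebraic set $Z\subset\mathbb R^N$ with $P_{\mathbb L_{S_1}(\mathbb V)}\not\subset Z$. **Theorem.** Let $\mathbb V$ be a generic basis of $\mathbb R^N$. Then for every $M\ge 0$: (i) (SR1) holds if $N>4M-6$ ($N$ even) or $N>4M-5$ ($N$ odd), and (SR2) holds if $N>4M-4$ ($N$ even) or $N>4M-3$ ($N$ odd). (ii) (SR1g) and (SR2g) hold if $N>2M-2$ ($N$ even) or $N>2M-1$ ($N$ odd). -/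

import Mathlib

namespace SparsePhase

/-- A subset of the affine space `ℝ^σ` is real algebraic (Zariski closed) if it is the common
zero set of some real polynomials. -/
def IsRealAlgebraic {σ : Type*} (Z : Set (σ → ℝ)) : Prop :=
  ∃ I : Ideal (MvPolynomial σ ℝ), Z = MvPolynomial.zeroLocus ℝ I

/-- A property holds generically on `X ⊆ ℝ^σ` if it holds at every point of some non-empty
(relatively) Zariski open subset `X \ Z` of `X`. -/
def HoldsGenerically {σ : Type*} (X : Set (σ → ℝ)) (p : (σ → ℝ) → Prop) : Prop :=
  ∃ Z : Set (σ → ℝ), IsRealAlgebraic Z ∧ (X \ Z).Nonempty ∧ ∀ x ∈ X \ Z, p x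

/-- The `N × N` discrete Fourier transform matrix `(ω^(kn))`, `0 ≤ k, n < N`,
with `ω = exp(2πi/N)`. -/
noncomputable def dftMatrix (N : ℕ) : Matrix (Fin N) (Fin N) ℂ :=
  Matrix.of fun k n => Complex.exp (2 * Real.pi * Complex.I / N) ^ ((k : ℕ) * (n : ℕ))

/-- The power spectrum `P_x = |F x|²` (componentwise) of a real vector. -/
noncomputable def powerSpectrum {N : ℕ} (x : Fin N → ℝ) : Fin N → ℝ :=
  fun k => ‖((dftMatrix N).mulVec fun n => (x n : ℂ)) k‖ ^ 2

/-- The set of ordered bases of `ℝ^N`, inside the affine space of all `N`-tuples of vectors of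
`ℝ^N`: the entry `A (i, j)` is the `j`-th coordinate of the `i`-th vector. -/
def bases (N : ℕ) : Set (Fin N × Fin N → ℝ) :=
  {A | LinearIndependent ℝ (Function.curry A) ∧
    Submodule.span ℝ (Set.range (Function.curry A)) = ⊤}

/-- A property holds for a generic (ordered) basis of `ℝ^N`. -/
def ForGenericBasis (N : ℕ) (p : (Fin N → Fin N → ℝ) → Prop) : Prop :=
  HoldsGenerically (bases N) fun A => p (Function.curry A)

/-- `L_S(V)`, the span of the vectors `v_i`, `i ∈ S`. -/
def L {N : ℕ} (V : Fin N → Fin N → ℝ) (S : Finset (Fin N)) : Submodule ℝ (Fin N → ℝ) :=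
  Submodule.span ℝ (V '' (S : Set (Fin N)))

/-- The image `P_W` of a linear subspace `W` under the power spectrum map. -/
def specImage {N : ℕ} (W : Submodule ℝ (Fin N → ℝ)) : Set (Fin N → ℝ) :=
  powerSpectrum '' (W : Set (Fin N → ℝ))

/-- `x = t y` for some `t ∈ S¹ ∩ ℝ`. -/
def EqUpToSign {N : ℕ} (x y : Fin N → ℝ) : Prop :=
  ∃ t : ℝ, ‖t‖ = 1 ∧ x = t • y

/-- Two vectors with the same support of size `M` and the same power spectrum agree up to sign. -/
def SR1 {N : ℕ} (V : Fin N → Fin N → ℝ) (M : ℕ) : Prop :=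
  ∀ S : Finset (Fin N), S.card = M → ∀ x ∈ L V S, ∀ y ∈ L V S,
    (powerSpectrum x = powerSpectrum y ↔ EqUpToSign x y)

/-- Power spectra common to two different supports come from the common subspace. -/
def SR2 {N : ℕ} (V : Fin N → Fin N → ℝ) (M : ℕ) : Prop :=
  ∀ S₁ S₂ : Finset (Fin N), S₁.card = M → S₂.card = M → S₁ ≠ S₂ →
    specImage (L V S₁) ∩ specImage (L V S₂) = specImage (L V S₁ ⊓ L V S₂)

/-- The generic version of `SR1`. -/
def SR1g {N : ℕ} (V : Fin N → Fin N → ℝ) (M : ℕ) : Prop :=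
  ∀ S : Finset (Fin N), S.card = M →
    HoldsGenerically (L V S : Set (Fin N → ℝ)) fun x =>
      ∀ y ∈ L V S, (powerSpectrum x = powerSpectrum y ↔ EqUpToSign x y)

/-- The generic version of `SR2`: for distinct supports, `P_{L_{S₁}} ∩ P_{L_{S₂}}` lies in a
proper real algebraic subset `P_{L_{S₁}} ∩ Z` of `P_{L_{S₁}}`. -/
def SR2g {N : ℕ} (V : Fin N → Fin N → ℝ) (M : ℕ) : Prop :=
  ∀ S₁ S₂ : Finset (Fin N), S₁.card = M → S₂.card = M → S₁ ≠ S₂ →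
    ∃ Z : Set (Fin N → ℝ), IsRealAlgebraic Z ∧
      specImage (L V S₁) ∩ specImage (L V S₂) ⊆ specImage (L V S₁) ∩ Z ∧
      specImage (L V S₁) ∩ Z ⊂ specImage (L V S₁)

end SparsePhase

namespace SparsePhase

/-! ### Polynomial functions on real affine space -/

open MvPolynomial

/-! The proof is a dimension count. The polynomial image of a space with fewer coordinates than the
target satisfies a non-zero polynomial equation (`Thin.range_of_card_lt`), so it suffices to cover
the bad families of vectors by finitely many such images.

Put `u = x + y` and `v = x - y`. Then `P_x = P_y` says that the Fourier coefficients of `u` and `v`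
are orthogonal in `ℝ²` at every frequency. Up to conjugation of frequencies these are `N / 2 + 1`
conditions (floor division), and finitely many polynomial charts with `2N - (N / 2 + 1)` parameters
cover all such pairs (`exists_pairChart_eq`): at each frequency either `u` vanishes or `v` is a real
multiple of `u` turned by a right angle.

If `x` and `y` are not equal up to sign, their coefficient vectors in the family are linearly
independent, so two members of the family can be solved for from `x`, `y`, the coefficients and the
other members (`recover_eq`). Bad families thus have `N² - (N / 2 + 1)` parameters plus the
coefficients. For (SR1), `u` and `v` lie in the same `L_S` and can be scaled separately, which
leaves `2M - 2` coefficients; for (SR2) only a common scaling of `x` and `y` is available, which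
leaves `2M - 1`.

For the generic statements the family is recorded together with `M` entries of `P_x`, in dimension
`N² + M`. Collisions form a thin set there (`thin_collisions`), whereas the points coming from all
of `L_S` lie in no thin set (`exists_eval_specPoint_ne_zero`). A polynomial vanishing on the
collisions therefore gives, for a generic family, a polynomial in the spectrum that separates them.
-/

theorem eval_bind₁_apply {τ σ : Type*} (t : τ → ℝ) (p : σ → MvPolynomial τ ℝ)
    (Q : MvPolynomial σ ℝ) : eval t (bind₁ p Q) = eval (fun s => eval t (p s)) Q := by
  rw [eval, eval₂Hom_bind₁]
  rfl

/-- A real function on `ℝ^τ` is polynomial. -/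
def IsPoly {τ : Type*} (f : (τ → ℝ) → ℝ) : Prop :=
  ∃ p : MvPolynomial τ ℝ, ∀ t, f t = eval t p

namespace IsPoly

variable {τ σ : Type*} {f g : (τ → ℝ) → ℝ}

theorem coord (i : τ) : IsPoly fun t : τ → ℝ => t i := ⟨X i, by simp⟩

theorem const (c : ℝ) : IsPoly fun _ : τ → ℝ => c := ⟨C c, by simp⟩

theorem add (hf : IsPoly f) (hg : IsPoly g) : IsPoly fun t => f t + g t := by
  obtain ⟨p, hp⟩ := hf
  obtain ⟨q, hq⟩ := hg
  exact ⟨p + q, by simp [hp, hq]⟩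

theorem sub (hf : IsPoly f) (hg : IsPoly g) : IsPoly fun t => f t - g t := by
  obtain ⟨p, hp⟩ := hf
  obtain ⟨q, hq⟩ := hg
  exact ⟨p - q, by simp [hp, hq]⟩

theorem mul (hf : IsPoly f) (hg : IsPoly g) : IsPoly fun t => f t * g t := by
  obtain ⟨p, hp⟩ := hf
  obtain ⟨q, hq⟩ := hg
  exact ⟨p * q, by simp [hp, hq]⟩

theorem pow (hf : IsPoly f) (n : ℕ) : IsPoly fun t => f t ^ n := by
  obtain ⟨p, hp⟩ := hf
  exact ⟨p ^ n, by simp [hp]⟩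

theorem sum {ι : Type*} (s : Finset ι) {F : ι → (τ → ℝ) → ℝ} (hF : ∀ i, IsPoly (F i)) :
    IsPoly fun t => ∑ i ∈ s, F i t := by
  choose p hp using hF
  exact ⟨∑ i ∈ s, p i, by simp [hp]⟩

theorem ite (c : Prop) [Decidable c] (hf : IsPoly f) (hg : IsPoly g) :
    IsPoly fun t => if c then f t else g t := by
  by_cases h : c <;> simpa [h]

theorem linear {ι κ : Type*} [Fintype ι] [DecidableEq ι] (l : (ι → ℝ) →ₗ[ℝ] (κ → ℝ)) (k : κ)
    {x : (τ → ℝ) → ι → ℝ} (hx : ∀ i, IsPoly fun t => x t i) : IsPoly fun t => l (x t) k := by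
  have h : (fun t => l (x t) k) = fun t => ∑ i, x t i * l (fun j => if i = j then 1 else 0) k := by
    funext t
    rw [LinearMap.pi_apply_eq_sum_univ l (x t), Finset.sum_apply]
    rfl
  rw [h]
  exact sum _ fun i => (hx i).mul (const _)

theorem eval_comp (Q : MvPolynomial σ ℝ) {F : (τ → ℝ) → σ → ℝ}
    (hF : ∀ s, IsPoly fun t => F t s) : IsPoly fun t => eval (F t) Q := by
  choose p hp using hF
  refine ⟨bind₁ p Q, fun t => ?_⟩
  have : F t = fun s => eval t (p s) := funext fun s => hp s t
  rw [eval_bind₁_apply, ← this]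

end IsPoly

/-- Extension of a family on a subtype by zero. -/
def extendZero {ι : Type*} (P : ι → Prop) [DecidablePred P] (p : {l // P l} → ℝ) (l : ι) : ℝ :=
  if h : P l then p ⟨l, h⟩ else 0

theorem extendZero_restrict {ι : Type*} {P : ι → Prop} [DecidablePred P] {a : ι → ℝ}
    (ha : ∀ l, ¬ P l → a l = 0) : extendZero P (fun l => a l) = a := by
  funext l
  by_cases h : P l
  · simp [extendZero, h]
  · simp [extendZero, h, ha l h]

theorem IsPoly.extendZero {τ ι : Type*} {P : ι → Prop} [DecidablePred P]
    {p : (τ → ℝ) → {l // P l} → ℝ} (hp : ∀ l, IsPoly fun t => p t l) (l : ι) :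
    IsPoly fun t => extendZero P (p t) l := by
  by_cases h : P l
  · simpa [SparsePhase.extendZero, h] using hp ⟨l, h⟩
  · simpa [SparsePhase.extendZero, h] using IsPoly.const 0

/-! ### Thin sets and the dimension count -/

/-- A subset of `ℝ^σ` is thin if some non-zero polynomial vanishes on it. -/
def Thin {σ : Type*} (Z : Set (σ → ℝ)) : Prop :=
  ∃ Q : MvPolynomial σ ℝ, Q ≠ 0 ∧ ∀ z ∈ Z, eval z Q = 0

namespace Thin

variable {σ τ : Type*}

theorem mono {Z W : Set (σ → ℝ)} (hW : Thin W) (h : Z ⊆ W) : Thin Z := by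
  obtain ⟨Q, hQ, hQW⟩ := hW
  exact ⟨Q, hQ, fun z hz => hQW z (h hz)⟩

theorem iUnion {ι : Type*} [Finite ι] {Z : ι → Set (σ → ℝ)} (h : ∀ i, Thin (Z i)) :
    Thin (⋃ i, Z i) := by
  have := Fintype.ofFinite ι
  choose Q hQ hQZ using h
  refine ⟨∏ i, Q i, Finset.prod_ne_zero_iff.2 fun i _ => hQ i, fun z hz => ?_⟩
  obtain ⟨i, hi⟩ := Set.mem_iUnion.1 hz
  rw [map_prod]
  exact Finset.prod_eq_zero (Finset.mem_univ i) (hQZ i z hi)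

theorem union {Z W : Set (σ → ℝ)} (hZ : Thin Z) (hW : Thin W) : Thin (Z ∪ W) := by
  rw [Set.union_eq_iUnion]
  exact iUnion fun b => by cases b <;> assumption

/-- The image of a polynomial map from a space of smaller dimension is thin. -/
theorem range_of_card_lt [Fintype σ] [Fintype τ] (h : Fintype.card τ < Fintype.card σ)
    {f : (τ → ℝ) → σ → ℝ} (hf : ∀ s, IsPoly fun t => f t s) : Thin (Set.range f) := by
  choose p hp using hf
  have hdep : ¬ AlgebraicIndependent ℝ p := by
    intro hi
    -- The transcendence degree of a polynomial ring is its number of variables, which bounds any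
    -- algebraically independent family.
    have := hi.lift_cardinalMk_le_trdeg
    simp only [MvPolynomial.trdeg_of_isDomain, Cardinal.mk_fintype, Cardinal.lift_natCast,
      Nat.cast_le] at this
    omega
  rw [algebraicIndependent_iff] at hdep
  push Not at hdep
  obtain ⟨Q, hQ, hQ0⟩ := hdep
  refine ⟨Q, hQ0, ?_⟩
  rintro _ ⟨t, rfl⟩
  have h1 : f t = fun s => eval t (p s) := funext fun s => hp s t
  have h2 := congrArg (eval t) hQ
  rw [map_zero] at h2
  rw [h1, ← eval_bind₁_apply]
  exact h2

theorem exists_notMem {Z : Set (σ → ℝ)} (h : Thin Z) : ∃ z, z ∉ Z := by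
  obtain ⟨Q, hQ, hQZ⟩ := h
  by_contra! H
  exact hQ (MvPolynomial.funext fun z => by simpa using hQZ z (H z))

end Thin

theorem isRealAlgebraic_of_isPoly {σ : Type*} {f : (σ → ℝ) → ℝ} (hf : IsPoly f) :
    IsRealAlgebraic {z | f z = 0} := by
  obtain ⟨p, hp⟩ := hf
  refine ⟨Ideal.span {p}, ?_⟩
  ext z
  simp [MvPolynomial.zeroLocus_span, hp, MvPolynomial.aeval_eq_eval]

/-- Multiplying the equation of the thin set by the determinant keeps it non-zero, so some actual
basis avoids the exceptional set; this gives the non-emptiness required of a generic property. -/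
theorem forGenericBasis_of_thin {N : ℕ} {p : (Fin N → Fin N → ℝ) → Prop}
    (h : Thin {A | A ∈ bases N ∧ ¬ p (Function.curry A)}) : ForGenericBasis N p := by
  obtain ⟨Q, hQ, hQZ⟩ := h
  refine ⟨_, isRealAlgebraic_of_isPoly ⟨Q, fun _ => rfl⟩, ?_, ?_⟩
  · obtain ⟨A, hA⟩ : ∃ A, A ∉ {A : Fin N × Fin N → ℝ |
        eval A (Q * (Matrix.mvPolynomialX (Fin N) (Fin N) ℝ).det) = 0} :=
      Thin.exists_notMem
        ⟨_, mul_ne_zero hQ (Matrix.det_mvPolynomialX_ne_zero (Fin N) ℝ), fun _ hz => hz⟩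
    simp only [Set.mem_ofPred_eq, map_mul, mul_eq_zero, not_or] at hA
    obtain ⟨hA1, hA2⟩ := hA
    refine ⟨A, ?_, hA1⟩
    have hdet : (Matrix.of (Function.curry A)).det ≠ 0 := by
      rw [RingHom.map_det] at hA2
      convert hA2 using 2
      ext i j
      simp [Matrix.mvPolynomialX, Function.curry]
    have hli : LinearIndependent ℝ (Function.curry A) :=
      Matrix.linearIndependent_rows_of_det_ne_zero hdet
    exact ⟨hli, hli.span_eq_top_of_card_eq_finrank' (by simp)⟩
  · rintro A ⟨hA, hAQ⟩
    by_contra hp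
    exact hAQ (hQZ A ⟨hA, hp⟩)

/-! ### The Fourier transform and the power spectrum -/

variable {N : ℕ}

/-- The discrete Fourier transform of a real vector. -/
noncomputable def dft (N : ℕ) : (Fin N → ℝ) →ₗ[ℝ] (Fin N → ℂ) :=
  ((dftMatrix N).mulVecLin.restrictScalars ℝ).comp
    (Complex.ofRealCLM.toLinearMap.compLeft (Fin N))

theorem dft_apply (x : Fin N → ℝ) : dft N x = (dftMatrix N).mulVec fun n => (x n : ℂ) := rfl

theorem dft_injective (N : ℕ) : Function.Injective (dft N) := by
  rcases Nat.eq_zero_or_pos N with rfl | hN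
  · exact Function.injective_of_subsingleton _
  have hdet : (dftMatrix N).det ≠ 0 := by
    have : dftMatrix N = Matrix.vandermonde fun k : Fin N =>
        Complex.exp (2 * Real.pi * Complex.I / N) ^ (k : ℕ) := by
      ext k n
      simp [dftMatrix, Matrix.vandermonde_apply, pow_mul]
    rw [this, Matrix.det_vandermonde_ne_zero_iff]
    intro k l hkl
    exact Fin.ext ((Complex.isPrimitiveRoot_exp N hN.ne').pow_inj k.2 l.2 hkl)
  intro x y h
  rw [dft_apply, dft_apply] at h
  have h' := Matrix.mulVec_injective_iff_isUnit.2
    ((Matrix.isUnit_iff_isUnit_det _).2 hdet.isUnit) h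
  funext n
  exact Complex.ofReal_injective (congrFun h' n)

theorem powerSpectrum_eq (x : Fin N → ℝ) (k : Fin N) :
    powerSpectrum x k = (dft N x k).re ^ 2 + (dft N x k).im ^ 2 := by
  rw [powerSpectrum, Complex.sq_norm, Complex.normSq_apply, dft_apply]
  ring

theorem powerSpectrum_smul (c : ℝ) (x : Fin N → ℝ) :
    powerSpectrum (c • x) = c ^ 2 • powerSpectrum x := by
  funext k
  simp only [powerSpectrum_eq, map_smul, Pi.smul_apply, Complex.smul_re, Complex.smul_im,
    smul_eq_mul]
  ring

theorem exists_powerSpectrum_ne_zero {x : Fin N → ℝ} (hx : x ≠ 0) :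
    ∃ k, powerSpectrum x k ≠ 0 := by
  by_contra! h
  refine hx (dft_injective N ?_)
  rw [map_zero]
  funext k
  have := h k
  rw [powerSpectrum_eq] at this
  apply Complex.ext <;> simp <;> nlinarith [sq_nonneg (dft N x k).re, sq_nonneg (dft N x k).im]

theorem powerSpectrum_eq_of_eqUpToSign {x y : Fin N → ℝ} (h : EqUpToSign x y) :
    powerSpectrum x = powerSpectrum y := by
  obtain ⟨t, ht, rfl⟩ := h
  rw [powerSpectrum_smul, ← sq_abs, ← Real.norm_eq_abs, ht, one_pow, one_smul]

/-- The spectrum scales by `c ^ 2`, and a non-zero vector has a non-zero spectral entry, which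
forces `c ^ 2 = 1`. -/
theorem eqUpToSign_of_eq_smul {x y : Fin N → ℝ} {c : ℝ} (h : powerSpectrum x = powerSpectrum y)
    (hy : y = c • x) : EqUpToSign x y := by
  by_cases hx : x = 0
  · exact ⟨1, by simp, by simp [hy, hx]⟩
  obtain ⟨k, hk⟩ := exists_powerSpectrum_ne_zero hx
  rw [hy, powerSpectrum_smul] at h
  have hc : c ^ 2 = 1 := by
    have h' := congrFun h k
    simp only [Pi.smul_apply, smul_eq_mul] at h'
    exact mul_right_cancel₀ hk (by linarith)
  refine ⟨c, ?_, ?_⟩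
  · rw [Real.norm_eq_abs]
    exact (pow_eq_one_iff_of_nonneg (abs_nonneg c) two_ne_zero).1 (by rw [sq_abs, hc])
  · rw [hy, smul_smul, ← sq, hc, one_smul]

theorem isPoly_dft_re (k : Fin N) {τ : Type*} {x : (τ → ℝ) → Fin N → ℝ}
    (hx : ∀ n, IsPoly fun t => x t n) : IsPoly fun t => (dft N (x t) k).re :=
  IsPoly.linear ((Complex.reCLM.toLinearMap.compLeft (Fin N)).comp (dft N)) k hx

theorem isPoly_dft_im (k : Fin N) {τ : Type*} {x : (τ → ℝ) → Fin N → ℝ}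
    (hx : ∀ n, IsPoly fun t => x t n) : IsPoly fun t => (dft N (x t) k).im :=
  IsPoly.linear ((Complex.imCLM.toLinearMap.compLeft (Fin N)).comp (dft N)) k hx

theorem isPoly_powerSpectrum (k : Fin N) {τ : Type*} {x : (τ → ℝ) → Fin N → ℝ}
    (hx : ∀ n, IsPoly fun t => x t n) : IsPoly fun t => powerSpectrum (x t) k := by
  simp only [powerSpectrum_eq]
  exact ((isPoly_dft_re k hx).pow 2).add ((isPoly_dft_im k hx).pow 2)

/-! ### Conjugate frequencies and real Fourier coordinates -/

/-- The index of the frequency conjugate to `k`. -/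
def conjIdx (k : Fin N) : Fin N := ⟨(N - k) % N, Nat.mod_lt _ (Nat.zero_lt_of_lt k.2)⟩

theorem conjIdx_val (k : Fin N) : (conjIdx k : ℕ) = if (k : ℕ) = 0 then 0 else N - k := by
  have := k.2
  unfold conjIdx
  split_ifs with h
  · simp [h]
  · exact Nat.mod_eq_of_lt (by omega)

theorem conjIdx_conjIdx (k : Fin N) : conjIdx (conjIdx k) = k := by
  have := k.2
  apply Fin.ext
  rw [conjIdx_val, conjIdx_val]
  split_ifs <;> omega

theorem dftMatrix_conjIdx (k n : Fin N) :
    dftMatrix N (conjIdx k) n = (starRingEnd ℂ) (dftMatrix N k n) := by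
  have hN : N ≠ 0 := (Nat.zero_lt_of_lt k.2).ne'
  have hω := Complex.isPrimitiveRoot_exp N hN
  simp only [dftMatrix, Matrix.of_apply]
  set ω := Complex.exp (2 * Real.pi * Complex.I / N) with hdef
  have hnorm : ‖ω‖ = 1 := Complex.norm_eq_one_of_pow_eq_one hω.pow_eq_one hN
  have h1 : ω ^ ((conjIdx k : ℕ) * n) * ω ^ ((k : ℕ) * n) = 1 := by
    rw [← pow_add, ← add_mul]
    apply (hω.pow_eq_one_iff_dvd _).2
    apply Dvd.dvd.mul_right
    rw [conjIdx_val]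
    split_ifs with h
    · simp [h]
    · rw [Nat.sub_add_cancel k.2.le]
  rw [eq_inv_of_mul_eq_one_left h1, Complex.inv_eq_conj (by rw [norm_pow, hnorm, one_pow])]

theorem dft_conjIdx (x : Fin N → ℝ) (k : Fin N) :
    dft N x (conjIdx k) = (starRingEnd ℂ) (dft N x k) := by
  simp [dft_apply, Matrix.mulVec, dotProduct, dftMatrix_conjIdx]

/-- Real coordinates on `ℝ^N` given by the real and imaginary parts of the Fourier coefficients. -/
noncomputable def realDft (N : ℕ) : (Fin N → ℝ) →ₗ[ℝ] (Fin N → ℝ) where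
  toFun x k := if N < 2 * (k : ℕ) then (dft N x k).im else (dft N x k).re
  map_add' x y := by
    funext k
    simp only [map_add, Pi.add_apply, Complex.add_im, Complex.add_re]
    split_ifs <;> rfl
  map_smul' c x := by
    funext k
    simp only [map_smul, Pi.smul_apply, Complex.smul_re, Complex.smul_im, RingHom.id_apply]
    split_ifs <;> rfl

theorem realDft_apply (x : Fin N → ℝ) (k : Fin N) :
    realDft N x k = if N < 2 * (k : ℕ) then (dft N x k).im else (dft N x k).re := rfl

theorem dft_re (x : Fin N → ℝ) (k : Fin N) :
    (dft N x k).re = realDft N x (if N < 2 * (k : ℕ) then conjIdx k else k) := by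
  have := k.2
  split_ifs with h
  · rw [realDft_apply, if_neg, dft_conjIdx, Complex.conj_re]
    rw [conjIdx_val]
    split_ifs <;> omega
  · rw [realDft_apply, if_neg h]

theorem dft_im_of_lt (x : Fin N → ℝ) {k : Fin N} (h : N < 2 * (k : ℕ)) :
    (dft N x k).im = realDft N x k := by
  rw [realDft_apply, if_pos h]

theorem dft_im_of_conjIdx_eq (x : Fin N → ℝ) {k : Fin N} (h : conjIdx k = k) :
    (dft N x k).im = 0 := by
  have := congrArg Complex.im (dft_conjIdx x k)
  rw [h, Complex.conj_im] at this
  linarith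

theorem conjIdx_cases (k : Fin N) :
    N < 2 * (k : ℕ) ∨ N < 2 * (conjIdx k : ℕ) ∨ conjIdx k = k := by
  have := k.2
  rw [Fin.ext_iff, conjIdx_val]
  split_ifs <;> omega

theorem realDft_injective (N : ℕ) : Function.Injective (realDft N) := by
  refine (injective_iff_map_eq_zero _).2 fun x hx => dft_injective N ?_
  rw [map_zero]
  have h0 : ∀ k, realDft N x k = 0 := fun k => by rw [hx]; rfl
  funext k
  refine Complex.ext (by rw [dft_re, h0]; rfl) ?_
  rcases conjIdx_cases k with h | h | h
  · rw [dft_im_of_lt x h, h0]; rfl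
  · have := dft_im_of_lt x h
    rw [dft_conjIdx, Complex.conj_im, h0] at this
    simpa using this
  · rw [dft_im_of_conjIdx_eq x h]; rfl

/-- `realDft` as a linear equivalence. -/
noncomputable def realDftEquiv (N : ℕ) : (Fin N → ℝ) ≃ₗ[ℝ] (Fin N → ℝ) :=
  LinearEquiv.ofInjectiveEndo (realDft N) (realDft_injective N)

theorem realDftEquiv_apply (x : Fin N → ℝ) : realDftEquiv N x = realDft N x := rfl

/-! ### Charts for pairs with equal power spectra -/

/-- Vectors with equal power spectra: the sum and the difference have orthogonal Fourier
coefficients. -/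
theorem re_mul_re_add_im_mul_im_eq_zero {x y : Fin N → ℝ}
    (h : powerSpectrum x = powerSpectrum y) (k : Fin N) :
    (dft N (x + y) k).re * (dft N (x - y) k).re +
      (dft N (x + y) k).im * (dft N (x - y) k).im = 0 := by
  have := congrFun h k
  rw [powerSpectrum_eq, powerSpectrum_eq] at this
  simp only [map_add, map_sub, Pi.add_apply, Pi.sub_apply, Complex.add_re, Complex.add_im,
    Complex.sub_re, Complex.sub_im]
  linarith

/-- The frequencies that index the two-dimensional blocks of `realDft`. -/
abbrev UpperFreq (N : ℕ) : Type := {k : Fin N // N < 2 * (k : ℕ)}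

/-- Conjugation pairs each upper frequency with a lower one, so the `N / 2 + 1` remaining indices
count the independent spectral conditions. -/
theorem card_upperFreq (hN : 0 < N) : Fintype.card (UpperFreq N) + (N / 2 + 1) = N := by
  have : Fintype.card (UpperFreq N) = (Finset.Ioi (⟨N / 2, by omega⟩ : Fin N)).card := by
    rw [Fintype.card_subtype]
    congr 1
    ext k
    simp only [Finset.mem_filter, Finset.mem_univ, true_and, Finset.mem_Ioi, Fin.lt_def]
    omega
  rw [this, Fin.card_Ioi]
  simp only
  omega

/-- The coordinates of the second vector of an orthogonal pair in terms of the first one. -/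
def orthCoord (w : Fin N → ℝ) (t : UpperFreq N → ℝ) (k : Fin N) : ℝ :=
  extendZero (fun k : Fin N => N < 2 * (k : ℕ)) t k * w (conjIdx k) -
    extendZero (fun k : Fin N => N < 2 * (k : ℕ)) t (conjIdx k) * w (conjIdx k)

/-- The chart, selected by `s`, of the variety of pairs with orthogonal Fourier coefficients. -/
noncomputable def pairChart (s : Fin N → Bool) (p : Fin N ⊕ UpperFreq N → ℝ) :
    (Fin N → ℝ) × (Fin N → ℝ) :=
  ((realDftEquiv N).symm fun k => if s k then p (.inl k) else 0,
    (realDftEquiv N).symm fun k =>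
      if s k then orthCoord (fun k => p (.inl k)) (fun k => p (.inr k)) k else p (.inl k))

theorem isPoly_orthCoord {τ : Type*} {w : (τ → ℝ) → Fin N → ℝ} {t : (τ → ℝ) → UpperFreq N → ℝ}
    (hw : ∀ k, IsPoly fun q => w q k) (ht : ∀ k, IsPoly fun q => t q k) (k : Fin N) :
    IsPoly fun q => orthCoord (w q) (t q) k :=
  ((IsPoly.extendZero ht k).mul (hw _)).sub ((IsPoly.extendZero ht _).mul (hw _))

theorem isPoly_pairChart {τ : Type*} (s : Fin N → Bool) {p : (τ → ℝ) → Fin N ⊕ UpperFreq N → ℝ}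
    (hp : ∀ k, IsPoly fun q => p q k) (n : Fin N) :
    IsPoly (fun q => (pairChart s (p q)).1 n) ∧ IsPoly (fun q => (pairChart s (p q)).2 n) :=
  ⟨IsPoly.linear (realDftEquiv N).symm.toLinearMap n fun _ =>
      IsPoly.ite _ (hp _) (IsPoly.const 0),
    IsPoly.linear (realDftEquiv N).symm.toLinearMap n fun k =>
      IsPoly.ite _ (isPoly_orthCoord (fun _ => hp _) (fun _ => hp _) k) (hp _)⟩

/-- The orthogonal complement of a non-zero vector `(p, q)` of the plane is the line through `(q,
-p)`. -/
theorem exists_rotation {p q r s : ℝ} (h : p * r + q * s = 0) (h0 : ¬ (p = 0 ∧ q = 0)) :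
    ∃ t, r = t * q ∧ s = - (t * p) := by
  have hpos : p ^ 2 + q ^ 2 ≠ 0 := fun h' => h0
    ⟨by nlinarith [sq_nonneg p, sq_nonneg q], by nlinarith [sq_nonneg p, sq_nonneg q]⟩
  refine ⟨(r * q - s * p) / (p ^ 2 + q ^ 2), ?_, ?_⟩
  · field_simp
    linear_combination p * h
  · field_simp
    linear_combination q * h

/-- The flag `s` marks the frequencies where `u` does not vanish. There `u` is free and `v` costs
one rotation parameter, or none at a self-conjugate frequency, where `v` must vanish; elsewhere `u =
0` and `v` is free. Hence the coordinate slots of `u` and `v` can be shared. -/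
theorem exists_pairChart_eq {u v : Fin N → ℝ}
    (h : ∀ k, (dft N u k).re * (dft N v k).re + (dft N u k).im * (dft N v k).im = 0) :
    ∃ s p, pairChart s p = (u, v) := by
  classical
  let s : Fin N → Bool := fun k => ! decide (realDft N u k = 0 ∧ realDft N u (conjIdx k) = 0)
  have hs : ∀ k, s k = true ↔ ¬ (realDft N u k = 0 ∧ realDft N u (conjIdx k) = 0) := fun k => by
    simp only [s, Bool.not_eq_true', decide_eq_false_iff_not]
  have hsc : ∀ k, s k = true → s (conjIdx k) = true := by
    intro k
    rw [hs, hs, conjIdx_conjIdx, and_comm]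
    exact id
  have hup : ∀ k : UpperFreq N, realDft N u k * realDft N v k +
      realDft N u (conjIdx k) * realDft N v (conjIdx k) = 0 := by
    rintro ⟨k, hk⟩
    have := h k
    rw [dft_re, dft_re, if_pos hk, dft_im_of_lt _ hk, dft_im_of_lt _ hk] at this
    linarith
  have ht : ∀ k : UpperFreq N, ∃ t : ℝ, s k = true →
      realDft N v k = t * realDft N u (conjIdx k) ∧
      realDft N v (conjIdx k) = - (t * realDft N u k) := by
    intro k
    by_cases hk : s k = true
    · obtain ⟨t, ht⟩ := exists_rotation (hup k) ((hs k).1 hk)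
      exact ⟨t, fun _ => ht⟩
    · exact ⟨0, fun h => absurd h hk⟩
  choose t ht using ht
  refine ⟨s, Sum.elim (fun k => if s k then realDft N u k else realDft N v k) t, ?_⟩
  refine Prod.ext ((LinearEquiv.symm_apply_eq _).2 ?_) ((LinearEquiv.symm_apply_eq _).2 ?_)
  · funext k
    rw [realDftEquiv_apply]
    by_cases hk : s k = true
    · simp [hk]
    · have := hk
      rw [hs, not_not] at this
      simp [hk, this.1]
  · funext k
    rw [realDftEquiv_apply]
    by_cases hk : s k = true
    · have hkc := hsc k hk
      have hnot : ∀ j : Fin N, N < 2 * (j : ℕ) → ¬ N < 2 * (conjIdx j : ℕ) := by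
        intro j hj
        have := j.2
        rw [conjIdx_val]
        split_ifs <;> omega
      simp only [hk, if_true, orthCoord, extendZero, Sum.elim_inl, Sum.elim_inr, hkc]
      -- In `orthCoord` the first term survives only at an upper index, the second only when the
      -- conjugate index is upper, and neither at a self-conjugate index.
      rcases conjIdx_cases k with h1 | h1 | h1
      · rw [dif_pos h1, dif_neg (hnot k h1), (ht ⟨k, h1⟩ hk).1]
        ring
      · have h2 : ¬ N < 2 * (k : ℕ) := by
          have := hnot _ h1
          rwa [conjIdx_conjIdx] at this
        have := (ht ⟨conjIdx k, h1⟩ hkc).2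
        simp only [conjIdx_conjIdx] at this
        rw [dif_pos h1, dif_neg h2, this]
        ring
      · have h2 : ¬ N < 2 * (k : ℕ) := fun h' => hnot k h' (by rwa [h1])
        have h3 := (hs k).1 hk
        rw [h1, and_self] at h3
        have h4 := h k
        rw [dft_re, dft_re, if_neg h2, dft_im_of_conjIdx_eq u h1, zero_mul, add_zero] at h4
        rw [h1, (mul_eq_zero.1 h4).resolve_left h3]
        ring
    · simp [hk]

/-! ### Recovering a family from two of its combinations -/

theorem exists_coeff_of_mem_L {V : Fin N → Fin N → ℝ} {S : Finset (Fin N)} {x : Fin N → ℝ}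
    (hx : x ∈ L V S) : ∃ a : Fin N → ℝ, (∀ l ∉ S, a l = 0) ∧ x = ∑ l, a l • V l := by
  obtain ⟨c, hc⟩ := (Submodule.mem_span_image_finset_iff_exists_fun' ℝ).1 hx
  refine ⟨fun l => if l ∈ S then c l else 0, fun l hl => by simp [hl], ?_⟩
  rw [← hc]
  simp [ite_smul, Finset.sum_ite_mem]

theorem sum_smul_mem_L {V : Fin N → Fin N → ℝ} {S : Finset (Fin N)} {a : Fin N → ℝ}
    (ha : ∀ l ∉ S, a l = 0) : ∑ l, a l • V l ∈ L V S := by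
  refine Submodule.sum_mem _ fun l _ => ?_
  by_cases hl : l ∈ S
  · exact Submodule.smul_mem _ _ (Submodule.subset_span ⟨l, hl, rfl⟩)
  · simp [ha l hl]

/-- Two linearly independent coefficient vectors have a non-zero minor at compatible positions. -/
theorem exists_minor_ne_zero {ι : Type*} {S₁ S₂ : Finset ι} {a b : ι → ℝ}
    (ha : ∀ l ∉ S₁, a l = 0) (hb : ∀ l ∉ S₂, b l = 0) (ha0 : a ≠ 0)
    (hab : ∀ c : ℝ, b ≠ c • a) :
    ∃ i ∈ S₁, ∃ j ∈ S₂, i ≠ j ∧ a i ≠ 0 ∧ a i * b j - b i * a j ≠ 0 := by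
  have hS : ∀ i, a i ≠ 0 → i ∈ S₁ := fun i hi => by_contra fun h => hi (ha i h)
  have hne : ∀ i j, a i * b j - b i * a j ≠ 0 → i ≠ j := by
    rintro i j h rfl
    exact h (by ring)
  -- If `a` has support outside `S₂`, then `b i = 0` there and any non-zero `b j` works. Otherwise
  -- the support of `a` is inside `S₂`, and so is every `j` with a non-zero minor.
  by_cases hsupp : ∃ i, a i ≠ 0 ∧ i ∉ S₂
  · obtain ⟨i, hi, hi2⟩ := hsupp
    obtain ⟨j, hj⟩ : ∃ j, b j ≠ 0 := by
      by_contra! h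
      exact hab 0 (by funext j; simp [h j])
    have hm : a i * b j - b i * a j ≠ 0 := by simp [hb i hi2, hi, hj]
    exact ⟨i, hS i hi, j, by_contra fun h => hj (hb j h), hne i j hm, hi, hm⟩
  · push Not at hsupp
    obtain ⟨i, hi⟩ := Function.ne_iff.1 ha0
    obtain ⟨j, hj⟩ : ∃ j, a i * b j - b i * a j ≠ 0 := by
      by_contra! h
      refine hab (b i / a i) (funext fun j => ?_)
      have := h j
      simp only [Pi.smul_apply, smul_eq_mul]
      rw [div_mul_eq_mul_div, eq_div_iff hi]
      linarith
    refine ⟨i, hS i hi, j, ?_, hne i j hj, hi, hj⟩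
    by_contra h
    have haj : a j = 0 := by_contra fun h' => h (hsupp j h')
    exact hj (by rw [hb j h, haj]; ring)

/-- The `j`-th vector of a family, recovered from two combinations of the family and the
remaining vectors. -/
def recoverSnd (i j : Fin N) (V : Fin N → Fin N → ℝ) (x y a b : Fin N → ℝ) (n : Fin N) : ℝ :=
  b j * (y n - b i * x n -
    ∑ l, if l ≠ i ∧ l ≠ j then (b l - b i * a l) * V l n else 0)

/-- The `i`-th vector of a family, recovered from two combinations of the family and the
remaining vectors. -/
def recoverFst (i j : Fin N) (V : Fin N → Fin N → ℝ) (x y a b : Fin N → ℝ) (n : Fin N) : ℝ :=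
  x n - a j * recoverSnd i j V x y a b n - ∑ l, if l ≠ i ∧ l ≠ j then a l * V l n else 0

/-- A family of vectors, recovered from two combinations of it and all but two of its members. -/
def recover (i j : Fin N) (V : Fin N → Fin N → ℝ) (x y a b : Fin N → ℝ) (q : Fin N × Fin N) : ℝ :=
  if q.1 = j then recoverSnd i j V x y a b q.2
  else if q.1 = i then recoverFst i j V x y a b q.2 else V q.1 q.2

theorem isPoly_recover {τ : Type*} (i j : Fin N) {V : (τ → ℝ) → Fin N → Fin N → ℝ}
    {x y a b : (τ → ℝ) → Fin N → ℝ} (hV : ∀ l n, IsPoly fun t => V t l n)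
    (hx : ∀ n, IsPoly fun t => x t n) (hy : ∀ n, IsPoly fun t => y t n)
    (ha : ∀ n, IsPoly fun t => a t n) (hb : ∀ n, IsPoly fun t => b t n) (q : Fin N × Fin N) :
    IsPoly fun t => recover i j (V t) (x t) (y t) (a t) (b t) q := by
  have h2 : ∀ n, IsPoly fun t => recoverSnd i j (V t) (x t) (y t) (a t) (b t) n := fun n =>
    (hb j).mul (((hy n).sub ((hb i).mul (hx n))).sub (IsPoly.sum _ fun l =>
      IsPoly.ite _ (((hb l).sub ((hb i).mul (ha l))).mul (hV l n)) (IsPoly.const 0)))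
  exact IsPoly.ite _ (h2 _) (IsPoly.ite _ (((hx _).sub ((ha j).mul (h2 _))).sub
    (IsPoly.sum _ fun l => IsPoly.ite _ ((ha l).mul (hV l _)) (IsPoly.const 0))) (hV _ _))

theorem sum_eq_add_add_sum_ite {ι : Type*} [Fintype ι] [DecidableEq ι] {i j : ι} (hij : i ≠ j)
    (f : ι → ℝ) : ∑ l, f l = f i + f j + ∑ l, if l ≠ i ∧ l ≠ j then f l else 0 := by
  have h : ∀ l, f l = (if l = i then f l else 0) + (if l = j then f l else 0) +
      if l ≠ i ∧ l ≠ j then f l else 0 := by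
    intro l
    by_cases h1 : l = i
    · subst h1
      simp [hij]
    · by_cases h2 : l = j <;> simp [h1, h2, hij.symm]
  rw [Finset.sum_congr rfl fun l _ => h l, Finset.sum_add_distrib, Finset.sum_add_distrib]
  simp

/-- Eliminating the `i`-th vector from `y - b i • x` leaves the `j`-th one multiplied by the minor
`b j - b i * a j`. The entry `b j` occurs nowhere else, so its slot in `b'` holds the inverse `ε` of
the minor; this keeps the recovery polynomial. The slot `a' i` is never read because `a i = 1`. -/
theorem recover_eq {i j : Fin N} (hij : i ≠ j) {A : Fin N × Fin N → ℝ}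
    {V : Fin N → Fin N → ℝ} {x y a b a' b' : Fin N → ℝ} {ε : ℝ}
    (hV : ∀ l, l ≠ i → l ≠ j → V l = Function.curry A l)
    (hx : x = ∑ l, a l • Function.curry A l) (hy : y = ∑ l, b l • Function.curry A l)
    (hai : a i = 1) (hε : ε * (b j - b i * a j) = 1)
    (ha' : ∀ l ≠ i, a' l = a l) (hb' : ∀ l ≠ j, b' l = b l) (hb'j : b' j = ε) :
    recover i j V x y a' b' = A := by
  have hx' : ∀ n, x n = A (i, n) + a j * A (j, n) +
      ∑ l, if l ≠ i ∧ l ≠ j then a l * A (l, n) else 0 := by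
    intro n
    rw [hx, Finset.sum_apply, sum_eq_add_add_sum_ite hij]
    simp [hai, Function.curry]
  have hy' : ∀ n, y n = b i * A (i, n) + b j * A (j, n) +
      ∑ l, if l ≠ i ∧ l ≠ j then b l * A (l, n) else 0 := by
    intro n
    rw [hy, Finset.sum_apply, sum_eq_add_add_sum_ite hij]
    simp [Function.curry]
  have h2 : ∀ n, recoverSnd i j V x y a' b' n = A (j, n) := by
    intro n
    have hs : (∑ l, if l ≠ i ∧ l ≠ j then (b' l - b' i * a' l) * V l n else 0) =
        (∑ l, if l ≠ i ∧ l ≠ j then b l * A (l, n) else 0) -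
          b i * ∑ l, if l ≠ i ∧ l ≠ j then a l * A (l, n) else 0 := by
      rw [Finset.mul_sum, ← Finset.sum_sub_distrib]
      refine Finset.sum_congr rfl fun l _ => ?_
      split_ifs with h
      · rw [hV l h.1 h.2, ha' l h.1, hb' l h.2, hb' i hij, Function.curry]
        ring
      · ring
    rw [recoverSnd, hs, hx', hy', hb'j, hb' i hij]
    linear_combination A (j, n) * hε
  funext ⟨l, n⟩
  simp only [recover]
  split_ifs with h h'
  · rw [h2, h]
  · have hs : (∑ l, if l ≠ i ∧ l ≠ j then a' l * V l n else 0) =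
        ∑ l, if l ≠ i ∧ l ≠ j then a l * A (l, n) else 0 := by
      refine Finset.sum_congr rfl fun l _ => ?_
      split_ifs with h
      · rw [hV l h.1 h.2, ha' l h.1, Function.curry]
      · rfl
    rw [recoverFst, h2, hs, hx', ha' j hij.symm, h']
    ring
  · rw [hV l h' h, Function.curry]

/-- Parameters for the vectors other than the `i`-th and the `j`-th one, and for a pair of vectors
with orthogonal Fourier coefficients. -/
abbrev BaseParam (i j : Fin N) : Type :=
  ({l : Fin N // l ≠ i ∧ l ≠ j} × Fin N) ⊕ (Fin N ⊕ UpperFreq N)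

/-- The total is `(N - 2) * N` for the kept vectors plus `2N - (N / 2 + 1)` for the orthogonal pair.
-/
theorem card_baseParam {i j : Fin N} (hij : i ≠ j) :
    Fintype.card (BaseParam i j) + (N / 2 + 1) = N * N := by
  have hN : 0 < N := Nat.zero_lt_of_lt i.2
  have h1 : Fintype.card {l : Fin N // l ≠ i ∧ l ≠ j} + 2 = N := by
    have h : Fintype.card {l : Fin N // l ≠ i ∧ l ≠ j} = (({i, j} : Finset (Fin N))ᶜ).card := by
      rw [Fintype.card_subtype]
      congr 1
      ext l
      simp
    have h2 := Finset.card_pair hij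
    have h3 := Finset.card_add_card_compl ({i, j} : Finset (Fin N))
    rw [Fintype.card_fin] at h3
    omega
  have h2 := card_upperFreq hN
  have h3 : Fintype.card {l : Fin N // l ≠ i ∧ l ≠ j} * N + 2 * N = N * N := by
    rw [← add_mul, h1]
  simp only [Fintype.card_sum, Fintype.card_prod, Fintype.card_fin]
  linarith

/-- The vectors other than the `i`-th and the `j`-th one. -/
def otherVectors {i j : Fin N} (p : BaseParam i j → ℝ) (l n : Fin N) : ℝ :=
  extendZero (fun l => l ≠ i ∧ l ≠ j) (fun l => p (.inl (l, n))) l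

theorem isPoly_otherVectors {τ : Type*} {i j : Fin N} {p : (τ → ℝ) → BaseParam i j → ℝ}
    (hp : ∀ k, IsPoly fun t => p t k) (l n : Fin N) : IsPoly fun t => otherVectors (p t) l n :=
  IsPoly.extendZero (fun _ => hp _) l

theorem exists_baseParam (i j : Fin N) (A : Fin N × Fin N → ℝ) (q : Fin N ⊕ UpperFreq N → ℝ) :
    ∃ p : BaseParam i j → ℝ, (∀ l, l ≠ i → l ≠ j → otherVectors p l = Function.curry A l) ∧
      (fun k => p (.inr k)) = q := by
  refine ⟨Sum.elim (fun r => A (r.1, r.2)) q, fun l h1 h2 => ?_, rfl⟩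
  funext n
  simp [otherVectors, extendZero, h1, h2, Function.curry]

/-! ### Algebraic independence of `M` spectral entries on `L_S` -/

theorem eq_zero_of_eventually_eval_eq_zero {σ : Type*} [Fintype σ] {Q : MvPolynomial σ ℝ}
    {z : σ → ℝ} (h : ∀ᶠ y in nhds z, eval y Q = 0) : Q = 0 := by
  obtain ⟨ε, hε, hball⟩ := Metric.eventually_nhds_iff_ball.1 h
  refine funext_set (fun s => Metric.ball (z s) ε) (fun s => ?_) fun y hy => ?_
  · rw [Real.ball_eq_Ioo]
    exact Set.Ioo_infinite (by linarith)
  · rw [map_zero]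
    refine hball y ?_
    rw [ball_pi z hε]
    exact hy

/-- A family of vectors together with the first `M` entries of the power spectrum of `x`. -/
noncomputable def specPoint (M : ℕ) (A : Fin N × Fin N → ℝ) (x : Fin N → ℝ) :
    (Fin N × Fin N) ⊕ {k : Fin N // (k : ℕ) < M} → ℝ :=
  Sum.elim A fun k => powerSpectrum x k

theorem isPoly_specPoint {τ : Type*} {M : ℕ} {A : (τ → ℝ) → Fin N × Fin N → ℝ}
    {x : (τ → ℝ) → Fin N → ℝ} (hA : ∀ q, IsPoly fun t => A t q) (hx : ∀ n, IsPoly fun t => x t n)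
    (s : (Fin N × Fin N) ⊕ {k : Fin N // (k : ℕ) < M}) :
    IsPoly fun t => specPoint M (A t) (x t) s := by
  rcases s with q | k
  · exact hA q
  · exact isPoly_powerSpectrum k.1 hx

/-- Since `2 * M ≤ N`, the first `M` frequencies are pairwise non-conjugate and lie below `N / 2`,
so their real parts are independent coordinates. -/
theorem exists_vectors_dft_eq_single {M : ℕ} (hM : 2 * M ≤ N) :
    ∃ v : {k : Fin N // (k : ℕ) < M} → Fin N → ℝ, ∀ j k : {k : Fin N // (k : ℕ) < M},
      (dft N (v j) k).re = (if j = k then 1 else 0) ∧ (dft N (v j) k).im = 0 := by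
  refine ⟨fun j => (realDftEquiv N).symm (Pi.single j.1 1), fun j k => ?_⟩
  have hv : ∀ i, realDft N ((realDftEquiv N).symm (Pi.single j.1 1)) i =
      if j.1 = i then 1 else 0 := by
    intro i
    rw [← realDftEquiv_apply, LinearEquiv.apply_symm_apply, Pi.single_apply]
    simp only [eq_comm]
  have hj := j.2
  have hk := k.2
  have hk' : ¬ N < 2 * ((k : Fin N) : ℕ) := by omega
  refine ⟨by rw [dft_re, if_neg hk', hv]; simp only [Subtype.ext_iff], ?_⟩
  rcases conjIdx_cases k.1 with h | h | h
  · exact absurd h hk'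
  · have h1 := dft_im_of_lt ((realDftEquiv N).symm (Pi.single j.1 1)) h
    rw [dft_conjIdx, Complex.conj_im, hv, if_neg (by rintro h'; rw [← h'] at h; omega)] at h1
    linarith
  · exact dft_im_of_conjIdx_eq _ h

/-- A non-zero polynomial in a family of vectors and `M` entries of a power spectrum does not
vanish on the power spectra of the combinations of `M` of the vectors. -/
theorem exists_eval_specPoint_ne_zero {M : ℕ} (hM : 2 * M ≤ N) {S : Finset (Fin N)}
    (hS : S.card = M) {Q : MvPolynomial ((Fin N × Fin N) ⊕ {k : Fin N // (k : ℕ) < M}) ℝ}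
    (hQ : Q ≠ 0) : ∃ (A : Fin N × Fin N → ℝ) (a : S → ℝ),
      eval (specPoint M A (∑ l : S, a l • Function.curry A l)) Q ≠ 0 := by
  by_contra! H
  obtain ⟨v, hv⟩ := exists_vectors_dft_eq_single hM
  have hcard : Fintype.card S = Fintype.card {k : Fin N // (k : ℕ) < M} := by
    rw [Fintype.card_coe, hS, Fintype.card_subtype, Fin.card_filter_val_lt]
    omega
  let e : S ≃ {k : Fin N // (k : ℕ) < M} := Fintype.equivOfCardEq hcard
  let row : Fin N → ((Fin N × Fin N → ℝ) × (S → ℝ)) →L[ℝ] (Fin N → ℝ) := fun l => ContinuousLinearMap.pi fun n =>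
    (ContinuousLinearMap.proj (l, n)).comp (ContinuousLinearMap.fst ℝ _ _)
  let cf : S → ((Fin N × Fin N → ℝ) × (S → ℝ)) →L[ℝ] ℝ := fun l =>
    (ContinuousLinearMap.proj l).comp (ContinuousLinearMap.snd ℝ _ _)
  -- Base point: the combination with all coefficients `1` has Fourier coefficient exactly `1` at
  -- each of the first `M` frequencies, so the derivative of the spectrum there is twice the real
  -- part.
  let e₀ : (Fin N × Fin N → ℝ) × (S → ℝ) := (fun q => if h : q.1 ∈ S then v (e ⟨q.1, h⟩) q.2 else 0, fun _ => 1)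
  have hrow₀ : ∀ l : S, row l e₀ = v (e l) := by
    intro l
    funext n
    exact dif_pos l.2
  have hcf₀ : ∀ l : S, cf l e₀ = 1 := fun l => rfl
  let D : ((Fin N × Fin N → ℝ) × (S → ℝ)) →L[ℝ] (Fin N → ℝ) :=
    ∑ l : S, (cf l e₀ • row l + (cf l).smulRight (row l e₀))
  have hD : HasStrictFDerivAt (fun p : (Fin N × Fin N → ℝ) × (S → ℝ) => ∑ l : S, cf l p • row l p) D e₀ :=
    HasStrictFDerivAt.fun_sum fun l _ =>
      (cf l).hasStrictFDerivAt.smul (row l).hasStrictFDerivAt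
  let R : Fin N → (Fin N → ℝ) →L[ℝ] ℝ := fun k => LinearMap.toContinuousLinearMap
    ((LinearMap.proj k).comp ((Complex.reCLM.toLinearMap.compLeft (Fin N)).comp (dft N)))
  let I : Fin N → (Fin N → ℝ) →L[ℝ] ℝ := fun k => LinearMap.toContinuousLinearMap
    ((LinearMap.proj k).comp ((Complex.imCLM.toLinearMap.compLeft (Fin N)).comp (dft N)))
  let F : (Fin N × Fin N → ℝ) × (S → ℝ) → (Fin N × Fin N) ⊕ {k : Fin N // (k : ℕ) < M} → ℝ := fun p =>
    specPoint M p.1 (∑ l : S, cf l p • row l p)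
  let F' : ((Fin N × Fin N → ℝ) × (S → ℝ)) →L[ℝ] ((Fin N × Fin N) ⊕ {k : Fin N // (k : ℕ) < M} → ℝ) :=
    ContinuousLinearMap.pi (Sum.elim
      (fun q => (ContinuousLinearMap.proj q).comp (ContinuousLinearMap.fst ℝ _ _))
      fun k => (2 : ℝ) • (R k).comp D)
  have hR : ∀ k : {k : Fin N // (k : ℕ) < M}, R k (∑ l : S, cf l e₀ • row l e₀) = 1 := by
    intro k
    have h : ∀ l, R k (v (e l)) = if e l = k then 1 else 0 := fun l => (hv (e l) k).1
    simp only [hcf₀, hrow₀, one_smul, map_sum, h]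
    rw [Finset.sum_eq_single (e.symm k)] <;> simp +contextual [Equiv.eq_symm_apply]
  have hI : ∀ k : {k : Fin N // (k : ℕ) < M}, I k (∑ l : S, cf l e₀ • row l e₀) = 0 := by
    intro k
    have h : ∀ l, I k (v (e l)) = 0 := fun l => (hv (e l) k).2
    simp only [hcf₀, hrow₀, one_smul, map_sum, h, Finset.sum_const_zero]
  have hF : HasStrictFDerivAt F F' e₀ := by
    refine hasStrictFDerivAt_pi'.2 fun s => ?_
    rcases s with q | k
    · exact ((ContinuousLinearMap.proj q).comp
        (ContinuousLinearMap.fst ℝ (Fin N × Fin N → ℝ) (S → ℝ))).hasStrictFDerivAt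
    · have h1 := (R k).hasStrictFDerivAt.comp e₀ hD
      have h2 := (I k).hasStrictFDerivAt.comp e₀ hD
      have h3 := (h1.mul h1).add (h2.mul h2)
      refine HasStrictFDerivAt.congr_fderiv (h3.congr_of_eventuallyEq (.of_forall fun p => ?_)) ?_
      · simp only [F, specPoint, Sum.elim_inr, powerSpectrum_eq, sq]
        rfl
      · simp only [hR, hI, zero_smul, add_zero, one_smul]
        exact (two_smul ℝ _).symm
  have hsurj : F'.range = ⊤ := by
    refine LinearMap.range_eq_top.2 fun z => ?_
    let B : Fin N × Fin N → ℝ := fun q => z (.inl q)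
    let y : Fin N → ℝ := ∑ l : S, Function.curry B l
    -- The family component of the target prescribes `B`. The coefficients then correct the spectral
    -- components, subtracting the contribution `y` of `B`.
    refine ⟨(B, fun l => z (.inr (e l)) / 2 - R (e l) y), ?_⟩
    funext s
    rcases s with q | k
    · rfl
    · have hDe : D (B, fun l => z (.inr (e l)) / 2 - R (e l) y) =
          y + ∑ l : S, (z (.inr (e l)) / 2 - R (e l) y) • v (e l) := by
        simp only [D, sum_apply, add_apply,
          ContinuousLinearMap.smulRight_apply, hcf₀, hrow₀,
          one_smul, Finset.sum_add_distrib]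
        rfl
      have h : ∀ l, R k (v (e l)) = if e l = k then 1 else 0 := fun l => (hv (e l) k).1
      change (2 : ℝ) * R k (D _) = z (.inr k)
      have hsum : R k (∑ l : S, (z (.inr (e l)) / 2 - R (e l) y) • v (e l)) =
          z (.inr k) / 2 - R k y := by
        rw [map_sum, Finset.sum_eq_single (e.symm k)]
        · rw [map_smul, h, e.apply_symm_apply, if_pos rfl, smul_eq_mul, mul_one]
        · intro l _ hl
          rw [map_smul, h, if_neg fun h' => hl ((Equiv.eq_symm_apply e).2 h'), smul_zero]
        · simp
      rw [hDe, map_add, hsum]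
      ring
  -- A surjective strict derivative makes `F` open at `e₀`, so `Q` would vanish on a whole
  -- neighbourhood.
  have hmap := hF.map_nhds_eq_of_surj hsurj
  refine hQ (eq_zero_of_eventually_eval_eq_zero (z := F e₀) ?_)
  rw [← hmap, Filter.eventually_map]
  exact .of_forall fun p => H p.1 p.2

/-! ### The condition (SR1) -/

theorem exists_independent_coeff {V : Fin N → Fin N → ℝ} {S₁ S₂ : Finset (Fin N)}
    {x y : Fin N → ℝ} (hx : x ∈ L V S₁) (hy : y ∈ L V S₂)
    (h : powerSpectrum x = powerSpectrum y) (hxy : ¬ EqUpToSign x y) :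
    ∃ a b : Fin N → ℝ, (∀ l ∉ S₁, a l = 0) ∧ (∀ l ∉ S₂, b l = 0) ∧ x = ∑ l, a l • V l ∧
      y = ∑ l, b l • V l ∧ a ≠ 0 ∧ ∀ c : ℝ, b ≠ c • a := by
  obtain ⟨a, ha, hxa⟩ := exists_coeff_of_mem_L hx
  obtain ⟨b, hb, hyb⟩ := exists_coeff_of_mem_L hy
  refine ⟨a, b, ha, hb, hxa, hyb, ?_, ?_⟩
  · rintro rfl
    have hx0 : x = 0 := by simp [hxa]
    obtain ⟨t, -, ht⟩ := eqUpToSign_of_eq_smul (c := 0) h.symm (by simp [hx0])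
    exact hxy ⟨1, by simp, by simp [ht, hx0]⟩
  · rintro c rfl
    refine hxy (eqUpToSign_of_eq_smul (c := c) h ?_)
    rw [hyb, hxa, Finset.smul_sum]
    simp [mul_smul]

/-- A family of vectors, parametrized by a pair of combinations of it, up to scaling of each, with
orthogonal Fourier coefficients and support in `S`. -/
noncomputable def orthogonalChart (S : Finset (Fin N)) (i j : Fin N) (s : Fin N → Bool)
    (t : BaseParam i j ⊕ ({l // l ∈ S ∧ l ≠ i} ⊕ {l // l ∈ S ∧ l ≠ j}) → ℝ) :
    Fin N × Fin N → ℝ :=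
  recover i j (otherVectors fun k => t (.inl k)) (pairChart s fun k => t (.inl (.inr k))).1
    (pairChart s fun k => t (.inl (.inr k))).2
    (extendZero (fun l => l ∈ S ∧ l ≠ i) fun l => t (.inr (.inl l)))
    (fun l => if l = j then 1 else
      extendZero (fun l => l ∈ S ∧ l ≠ j) (fun l => t (.inr (.inr l))) l)

theorem isPoly_orthogonalChart (S : Finset (Fin N)) (i j : Fin N) (s : Fin N → Bool)
    (q : Fin N × Fin N) : IsPoly fun t => orthogonalChart S i j s t q :=
  isPoly_recover i j (isPoly_otherVectors fun _ => IsPoly.coord _)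
    (fun n => (isPoly_pairChart s (fun _ => IsPoly.coord _) n).1)
    (fun n => (isPoly_pairChart s (fun _ => IsPoly.coord _) n).2)
    (IsPoly.extendZero fun _ => IsPoly.coord _)
    (fun _ => IsPoly.ite _ (IsPoly.const 1) (IsPoly.extendZero (fun _ => IsPoly.coord _) _)) q

theorem card_mem_and_ne {S : Finset (Fin N)} {i : Fin N} (hi : i ∈ S) :
    Fintype.card {l // l ∈ S ∧ l ≠ i} + 1 = S.card := by
  have : Fintype.card {l // l ∈ S ∧ l ≠ i} = (S.erase i).card := by
    rw [Fintype.card_subtype]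
    congr 1
    ext l
    simp [and_comm]
  rw [this, Finset.card_erase_add_one hi]

/-- The parameters number `N * N - (N / 2 + 1) + 2 * (S.card - 1)`, which is below `N * N` exactly
under `hS`. -/
theorem thin_range_orthogonalChart {S : Finset (Fin N)} (hS : 2 * S.card ≤ N / 2 + 2)
    {i j : Fin N} (hij : i ≠ j) (hi : i ∈ S) (hj : j ∈ S) (s : Fin N → Bool) :
    Thin (Set.range (orthogonalChart S i j s)) := by
  refine Thin.range_of_card_lt ?_ (isPoly_orthogonalChart S i j s)
  have h1 := card_baseParam hij
  have h2 := card_mem_and_ne hi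
  have h3 := card_mem_and_ne hj
  rw [Fintype.card_sum (α := BaseParam i j), Fintype.card_sum (α := {l // l ∈ S ∧ l ≠ i}),
    Fintype.card_prod, Fintype.card_fin]
  omega

theorem exists_orthogonalChart_eq {S : Finset (Fin N)} {A : Fin N × Fin N → ℝ}
    {x y : Fin N → ℝ} (hx : x ∈ L (Function.curry A) S) (hy : y ∈ L (Function.curry A) S)
    (h : powerSpectrum x = powerSpectrum y) (hxy : ¬ EqUpToSign x y) :
    ∃ i ∈ S, ∃ j ∈ S, i ≠ j ∧ ∃ s, A ∈ Set.range (orthogonalChart S i j s) := by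
  obtain ⟨a, b, ha, hb, hxa, hyb, ha0, hab⟩ := exists_independent_coeff hx hy h hxy
  -- The coefficients of `x + y` and `x - y` are again independent: a relation `a - b = c • (a + b)`
  -- gives `a = 0` for `c = -1`, and otherwise makes `b` a multiple of `a`.
  obtain ⟨i, hi, j, hj, hij, hai, hm⟩ := exists_minor_ne_zero (S₁ := S) (S₂ := S) (a := a + b)
    (b := a - b) (fun l hl => by simp [ha l hl, hb l hl]) (fun l hl => by simp [ha l hl, hb l hl])
    (fun h0 => hab (-1) (by rw [neg_one_smul]; exact eq_neg_of_add_eq_zero_right h0))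
    (fun c hc => by
      by_cases hc1 : c = -1
      · apply ha0
        funext l
        have := congrFun hc l
        simp only [hc1, Pi.sub_apply, Pi.smul_apply, Pi.add_apply, smul_eq_mul] at this
        simp only [Pi.zero_apply]
        linarith
      · have hc2 : 1 + c ≠ 0 := fun h' => hc1 (by linarith)
        apply hab ((1 - c) / (1 + c))
        funext l
        have := congrFun hc l
        simp only [Pi.sub_apply, Pi.smul_apply, Pi.add_apply, smul_eq_mul] at this ⊢
        rw [div_mul_eq_mul_div, eq_div_iff hc2]
        linarith)
  set α := a + b with hα
  set γ := a - b with hγ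
  set Δ := α i * γ j - γ i * α j with hΔ
  have hu : x + y = ∑ l, α l • Function.curry A l := by
    rw [hxa, hyb, ← Finset.sum_add_distrib]
    simp [hα, add_smul]
  have hv : x - y = ∑ l, γ l • Function.curry A l := by
    rw [hxa, hyb, ← Finset.sum_sub_distrib]
    simp [hγ, sub_smul]
  -- Orthogonality survives independent scalings of the two vectors. These factors make the `i`-th
  -- coefficient of the first vector and the minor both equal to `1`, saving two parameters.
  obtain ⟨s, q, hsq⟩ := exists_pairChart_eq (u := (α i)⁻¹ • (x + y)) (v := (α i / Δ) • (x - y))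
    (fun k => by
      have := re_mul_re_add_im_mul_im_eq_zero h k
      rw [map_smul, map_smul, Pi.smul_apply, Pi.smul_apply, Complex.smul_re, Complex.smul_re,
        Complex.smul_im, Complex.smul_im]
      simp only [smul_eq_mul]
      linear_combination (α i)⁻¹ * (α i / Δ) * this)
  obtain ⟨p, hp, hpq⟩ := exists_baseParam i j A q
  refine ⟨i, hi, j, hj, hij, s, Sum.elim p (Sum.elim (fun l => (α i)⁻¹ * α l)
    (fun l => α i / Δ * γ l)), ?_⟩
  have hsupp : ∀ l ∉ S, α l = 0 ∧ γ l = 0 := fun l hl => by simp [hα, hγ, ha l hl, hb l hl]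
  refine recover_eq hij (ε := 1) (a := fun l => (α i)⁻¹ * α l) (b := fun l => α i / Δ * γ l)
    hp ?_ ?_ (inv_mul_cancel₀ hai) ?_ (fun l hl => ?_) (fun l hl => ?_) (if_pos rfl)
  · simp only [Sum.elim_inl, hpq, hsq, hu, Finset.smul_sum, mul_smul]
  · simp only [Sum.elim_inl, hpq, hsq, hv, Finset.smul_sum, mul_smul]
  · have : α i / Δ * γ j - α i / Δ * γ i * ((α i)⁻¹ * α j) = Δ / Δ := by
      rw [hΔ]
      field_simp
    rw [this, div_self hm, one_mul]
  · by_cases hlS : l ∈ S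
    · simp [extendZero, hlS, hl]
    · simp [extendZero, hlS, (hsupp l hlS).1]
  · by_cases hlS : l ∈ S
    · simp [extendZero, hlS, hl]
    · simp [extendZero, hlS, hl, (hsupp l hlS).2]

theorem thin_not_SR1 {M : ℕ} (hM : 2 * M ≤ N / 2 + 2) :
    Thin {A : Fin N × Fin N → ℝ | ¬ SR1 (Function.curry A) M} := by
  refine Thin.mono (Thin.iUnion (ι := {q : Finset (Fin N) × Fin N × Fin N × (Fin N → Bool) //
    q.1.card = M ∧ q.2.1 ∈ q.1 ∧ q.2.2.1 ∈ q.1 ∧ q.2.1 ≠ q.2.2.1})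
    (Z := fun q => Set.range (orthogonalChart q.1.1 q.1.2.1 q.1.2.2.1 q.1.2.2.2)) ?_) ?_
  · rintro ⟨⟨S, i, j, s⟩, hS, hi, hj, hij⟩
    exact thin_range_orthogonalChart (by omega) hij hi hj s
  · intro A hA
    by_contra hcon
    refine hA fun S hS x hx y hy =>
      ⟨fun h => by_contra fun hxy => hcon ?_, powerSpectrum_eq_of_eqUpToSign⟩
    obtain ⟨i, hi, j, hj, hij, s, hs⟩ := exists_orthogonalChart_eq hx hy h hxy
    exact Set.mem_iUnion.2 ⟨⟨⟨S, i, j, s⟩, hS, hi, hj, hij⟩, hs⟩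

/-! ### The condition (SR2) -/

/-- The parameters for `supportChart`. -/
abbrev SupportParam (S₁ S₂ : Finset (Fin N)) (i j : Fin N) : Type :=
  BaseParam i j ⊕ ({l // l ∈ S₁ ∧ l ≠ i} ⊕ {l // l ∈ S₂})

/-- The first vector of a pair with equal power spectra. -/
noncomputable def equalSpectrumFst {S₁ S₂ : Finset (Fin N)} {i j : Fin N} (s : Fin N → Bool)
    (t : SupportParam S₁ S₂ i j → ℝ) (n : Fin N) : ℝ :=
  1 / 2 * ((pairChart s fun k => t (.inl (.inr k))).1 n +
    (pairChart s fun k => t (.inl (.inr k))).2 n)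

/-- The second vector of a pair with equal power spectra. -/
noncomputable def equalSpectrumSnd {S₁ S₂ : Finset (Fin N)} {i j : Fin N} (s : Fin N → Bool)
    (t : SupportParam S₁ S₂ i j → ℝ) (n : Fin N) : ℝ :=
  1 / 2 * ((pairChart s fun k => t (.inl (.inr k))).1 n -
    (pairChart s fun k => t (.inl (.inr k))).2 n)

/-- A family of vectors, parametrized by a pair of combinations of it, up to common scaling, with
equal power spectra and supports in `S₁` and `S₂`. -/
noncomputable def supportChart (S₁ S₂ : Finset (Fin N)) (i j : Fin N) (s : Fin N → Bool)
    (t : SupportParam S₁ S₂ i j → ℝ) : Fin N × Fin N → ℝ :=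
  recover i j (otherVectors fun k => t (.inl k)) (equalSpectrumFst s t) (equalSpectrumSnd s t)
    (extendZero (fun l => l ∈ S₁ ∧ l ≠ i) fun l => t (.inr (.inl l)))
    (extendZero (fun l => l ∈ S₂) fun l => t (.inr (.inr l)))

section

variable {τ : Type*} {S₁ S₂ : Finset (Fin N)} {i j : Fin N} (s : Fin N → Bool)
  {t : (τ → ℝ) → SupportParam S₁ S₂ i j → ℝ}

theorem isPoly_equalSpectrumFst (ht : ∀ k, IsPoly fun r => t r k) (n : Fin N) :
    IsPoly fun r => equalSpectrumFst s (t r) n :=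
  (IsPoly.const _).mul ((isPoly_pairChart s (fun _ => ht _) n).1.add
    (isPoly_pairChart s (fun _ => ht _) n).2)

theorem isPoly_equalSpectrumSnd (ht : ∀ k, IsPoly fun r => t r k) (n : Fin N) :
    IsPoly fun r => equalSpectrumSnd s (t r) n :=
  (IsPoly.const _).mul ((isPoly_pairChart s (fun _ => ht _) n).1.sub
    (isPoly_pairChart s (fun _ => ht _) n).2)

theorem isPoly_supportChart (ht : ∀ k, IsPoly fun r => t r k) (q : Fin N × Fin N) :
    IsPoly fun r => supportChart S₁ S₂ i j s (t r) q :=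
  isPoly_recover i j (isPoly_otherVectors fun _ => ht _) (isPoly_equalSpectrumFst s ht)
    (isPoly_equalSpectrumSnd s ht) (IsPoly.extendZero fun _ => ht _)
    (IsPoly.extendZero fun _ => ht _) q

end

theorem card_supportParam {S₁ S₂ : Finset (Fin N)} {i j : Fin N} (hij : i ≠ j) (hi : i ∈ S₁) :
    Fintype.card (SupportParam S₁ S₂ i j) + (N / 2 + 2) = N * N + S₁.card + S₂.card := by
  have h1 := card_baseParam hij
  have h2 := card_mem_and_ne hi
  have h3 : Fintype.card {l // l ∈ S₂} = S₂.card := Fintype.card_coe S₂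
  rw [Fintype.card_sum (α := BaseParam i j), Fintype.card_sum (α := {l // l ∈ S₁ ∧ l ≠ i}), h3]
  omega

/-- With different supports, `x ± y` need not lie in either subspace, so `x` and `y` themselves are
used. Equality of spectra allows only a common scaling, which normalizes `a i`; the factor `c`
restores `x`. -/
theorem exists_supportChart_eq {S₁ S₂ : Finset (Fin N)} {A : Fin N × Fin N → ℝ}
    {x y : Fin N → ℝ} (hx : x ∈ L (Function.curry A) S₁) (hy : y ∈ L (Function.curry A) S₂)
    (h : powerSpectrum x = powerSpectrum y) (hxy : ¬ EqUpToSign x y) :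
    ∃ i ∈ S₁, ∃ j, i ≠ j ∧ ∃ s t, ∃ c : ℝ, supportChart S₁ S₂ i j s t = A ∧
      x = c • equalSpectrumFst s t := by
  obtain ⟨a, b, ha, hb, hxa, hyb, ha0, hab⟩ := exists_independent_coeff hx hy h hxy
  obtain ⟨i, hi, j, hj, hij, hai, hm⟩ := exists_minor_ne_zero ha hb ha0 hab
  set Δ := a i * b j - b i * a j with hΔ
  obtain ⟨s, q, hsq⟩ := exists_pairChart_eq (u := (a i)⁻¹ • (x + y)) (v := (a i)⁻¹ • (x - y))
    (fun k => by
      have := re_mul_re_add_im_mul_im_eq_zero h k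
      rw [map_smul, map_smul, Pi.smul_apply, Pi.smul_apply, Complex.smul_re, Complex.smul_re,
        Complex.smul_im, Complex.smul_im]
      simp only [smul_eq_mul]
      linear_combination (a i)⁻¹ * (a i)⁻¹ * this)
  obtain ⟨p, hp, hpq⟩ := exists_baseParam i j A q
  -- After division by `a i` the minor becomes `Δ / a i ^ 2`; slot `j` holds its inverse.
  let b' : Fin N → ℝ := fun l => if l = j then a i ^ 2 / Δ else (a i)⁻¹ * b l
  let t : SupportParam S₁ S₂ i j → ℝ :=
    Sum.elim p (Sum.elim (fun l => (a i)⁻¹ * a l) (fun l => b' l))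
  have ht : (pairChart s fun k => t (.inl (.inr k))) =
      ((a i)⁻¹ • (x + y), (a i)⁻¹ • (x - y)) := by
    rw [← hsq, ← hpq]
    rfl
  have hfst : equalSpectrumFst s t = (a i)⁻¹ • x := by
    funext n
    simp only [equalSpectrumFst, ht, Pi.smul_apply, Pi.add_apply, Pi.sub_apply, smul_eq_mul]
    ring
  have hsnd : equalSpectrumSnd s t = (a i)⁻¹ • y := by
    funext n
    simp only [equalSpectrumSnd, ht, Pi.smul_apply, Pi.add_apply, Pi.sub_apply, smul_eq_mul]
    ring
  refine ⟨i, hi, j, hij, s, t, a i, ?_, by rw [hfst, smul_inv_smul₀ hai]⟩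
  refine recover_eq hij (ε := a i ^ 2 / Δ) (a := fun l => (a i)⁻¹ * a l)
    (b := fun l => (a i)⁻¹ * b l) hp ?_ ?_ (inv_mul_cancel₀ hai) ?_ (fun l hl => ?_)
    (fun l hl => ?_) ?_
  · rw [hfst, hxa, Finset.smul_sum]
    simp only [mul_smul]
  · rw [hsnd, hyb, Finset.smul_sum]
    simp only [mul_smul]
  · have : a i ^ 2 / Δ * ((a i)⁻¹ * b j - (a i)⁻¹ * b i * ((a i)⁻¹ * a j)) = Δ / Δ := by
      rw [hΔ]
      field_simp
    rw [this, div_self hm]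
  · by_cases hlS : l ∈ S₁
    · simp [extendZero, hlS, hl, t]
    · simp [extendZero, hlS, ha l hlS]
  · by_cases hlS : l ∈ S₂
    · simp [extendZero, hlS, hl, t, b']
    · simp [extendZero, hlS, hb l hlS]
  · simp [extendZero, hj, t, b']

theorem thin_not_SR2 {M : ℕ} (hM : 2 * M ≤ N / 2 + 1) :
    Thin {A : Fin N × Fin N → ℝ | ¬ SR2 (Function.curry A) M} := by
  refine Thin.mono (Thin.iUnion (ι := {q : Finset (Fin N) × Finset (Fin N) × Fin N × Fin N ×
      (Fin N → Bool) // q.1.card = M ∧ q.2.1.card = M ∧ q.2.2.1 ∈ q.1 ∧ q.2.2.1 ≠ q.2.2.2.1})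
    (Z := fun q => Set.range
      (supportChart q.1.1 q.1.2.1 q.1.2.2.1 q.1.2.2.2.1 q.1.2.2.2.2)) ?_) ?_
  · rintro ⟨⟨S₁, S₂, i, j, s⟩, hS₁, hS₂, hi, hij⟩
    simp only at hS₁ hS₂ hi hij
    refine Thin.range_of_card_lt ?_ (isPoly_supportChart s IsPoly.coord)
    have := card_supportParam (S₂ := S₂) hij hi
    simp only [Fintype.card_prod, Fintype.card_fin]
    omega
  · intro A hA
    by_contra hcon
    refine hA fun S₁ S₂ hS₁ hS₂ _ => Set.Subset.antisymm ?_ ?_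
    · rintro _ ⟨⟨x, hx, rfl⟩, ⟨y, hy, hyx⟩⟩
      by_cases hxy : EqUpToSign x y
      · obtain ⟨t, -, rfl⟩ := hxy
        exact ⟨_, ⟨hx, Submodule.smul_mem _ t hy⟩, rfl⟩
      · obtain ⟨i, hi, j, hij, s, t, c, hA, -⟩ := exists_supportChart_eq hx hy hyx.symm hxy
        exact (hcon (Set.mem_iUnion.2 ⟨⟨⟨S₁, S₂, i, j, s⟩, hS₁, hS₂, hi, hij⟩, t, hA⟩)).elim
    · rintro _ ⟨x, ⟨hx₁, hx₂⟩, rfl⟩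
      exact ⟨⟨x, hx₁, rfl⟩, ⟨x, hx₂, rfl⟩⟩

/-! ### The generic conditions (SR1g) and (SR2g) -/

/-- The families of vectors, together with `M` entries of the power spectra that combinations of
them with support in `S₁` share with combinations with support in `S₂`. -/
def collisions (M : ℕ) (S₁ S₂ : Finset (Fin N)) :
    Set ((Fin N × Fin N) ⊕ {k : Fin N // (k : ℕ) < M} → ℝ) :=
  {z | ∃ A, ∃ x ∈ L (Function.curry A) S₁, ∃ y ∈ L (Function.curry A) S₂,
    powerSpectrum x = powerSpectrum y ∧ ¬ EqUpToSign x y ∧ specPoint M A x = z}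

theorem card_specPoint {M : ℕ} (hM : M ≤ N) :
    Fintype.card ((Fin N × Fin N) ⊕ {k : Fin N // (k : ℕ) < M}) = N * N + M := by
  rw [Fintype.card_sum, Fintype.card_prod, Fintype.card_fin, Fintype.card_subtype,
    Fin.card_filter_val_lt, min_eq_right hM]

/-- The scale of `x` adds one parameter to `supportChart`, and `N * N + 2 * M - (N / 2 + 1)` is less
than `N * N + M` exactly when `M ≤ N / 2`. -/
theorem thin_collisions {M : ℕ} (hM : M ≤ N / 2) {S₁ S₂ : Finset (Fin N)} (hS₁ : S₁.card = M)
    (hS₂ : S₂.card = M) : Thin (collisions M S₁ S₂) := by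
  let f (i j : Fin N) (s : Fin N → Bool) (t : SupportParam S₁ S₂ i j ⊕ Unit → ℝ) :=
    specPoint M (supportChart S₁ S₂ i j s fun k => t (.inl k)) fun n =>
      t (.inr ()) * equalSpectrumFst s (fun k => t (.inl k)) n
  refine Thin.mono (Thin.iUnion (ι := {q : Fin N × Fin N × (Fin N → Bool) //
    q.1 ∈ S₁ ∧ q.1 ≠ q.2.1}) (Z := fun q => Set.range (f q.1.1 q.1.2.1 q.1.2.2)) ?_) ?_
  · rintro ⟨⟨i, j, s⟩, hi, hij⟩
    simp only at hi hij
    refine Thin.range_of_card_lt ?_ (isPoly_specPoint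
      (isPoly_supportChart s fun _ => IsPoly.coord _)
      fun n => (IsPoly.coord _).mul (isPoly_equalSpectrumFst s (fun _ => IsPoly.coord _) n))
    have := card_supportParam (S₂ := S₂) hij hi
    rw [card_specPoint (by omega), Fintype.card_sum (α := SupportParam S₁ S₂ i j),
      Fintype.card_unit]
    omega
  · rintro _ ⟨A, x, hx, y, hy, h, hxy, rfl⟩
    obtain ⟨i, hi, j, hij, s, t, c, hA, hc⟩ := exists_supportChart_eq hx hy h hxy
    refine Set.mem_iUnion.2 ⟨⟨⟨i, j, s⟩, hi, hij⟩, Sum.elim t fun _ => c, ?_⟩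
    rw [hc, ← hA]
    rfl

/-- Handles the trivial collisions `x = ±y` in (SR2g), which lie in the span of fewer than `M`
vectors. -/
theorem thin_smallSupport {M : ℕ} (hM : M ≤ N) {T : Finset (Fin N)} (hT : T.card < M) :
    Thin {z | ∃ A, ∃ x ∈ L (Function.curry A) T, specPoint M A x = z} := by
  refine Thin.mono (Thin.range_of_card_lt (τ := (Fin N × Fin N) ⊕ {l // l ∈ T})
    (f := fun t => specPoint M (fun q => t (.inl q)) fun n =>
      ∑ l, extendZero (fun l => l ∈ T) (fun l => t (.inr l)) l * t (.inl (l, n))) ?_ ?_) ?_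
  · have h3 : Fintype.card {l // l ∈ T} = T.card := Fintype.card_coe T
    rw [card_specPoint hM, Fintype.card_sum, Fintype.card_prod, Fintype.card_fin, h3]
    omega
  · exact isPoly_specPoint (fun _ => IsPoly.coord _) fun n => IsPoly.sum _ fun l =>
      (IsPoly.extendZero (fun _ => IsPoly.coord _) l).mul (IsPoly.coord _)
  · rintro _ ⟨A, x, hx, rfl⟩
    obtain ⟨a, ha, rfl⟩ := exists_coeff_of_mem_L hx
    refine ⟨Sum.elim A fun l => a l, ?_⟩
    simp only [Sum.elim_inl, Sum.elim_inr, extendZero_restrict ha]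
    congr 1
    funext n
    simp [Finset.sum_apply, Function.curry]

/-- For a generic family of vectors, a thin set of spectra is separated by a polynomial from the
spectra of the combinations with support in `S`. -/
theorem thin_not_separated {M : ℕ} (hM : M ≤ N / 2) {S : Finset (Fin N)} (hS : S.card = M)
    {W : Set ((Fin N × Fin N) ⊕ {k : Fin N // (k : ℕ) < M} → ℝ)} (hW : Thin W) :
    Thin {A : Fin N × Fin N → ℝ | ¬ ∃ g : (Fin N → ℝ) → ℝ, IsPoly g ∧
      (∀ x, specPoint M A x ∈ W → g (powerSpectrum x) = 0) ∧
      ∃ x ∈ L (Function.curry A) S, g (powerSpectrum x) ≠ 0} := by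
  obtain ⟨Q, hQ, hQW⟩ := hW
  -- Freezing the coefficients `a₀` turns `Q` into a non-zero polynomial in the family alone.
  -- Wherever it is non-zero, `Q` with the family frozen is the separating polynomial.
  obtain ⟨A₀, a₀, h₀⟩ := exists_eval_specPoint_ne_zero (by omega) hS hQ
  obtain ⟨R, hR⟩ : IsPoly fun A : Fin N × Fin N → ℝ =>
      eval (specPoint M A (∑ l : S, a₀ l • Function.curry A l)) Q := by
    refine IsPoly.eval_comp Q (isPoly_specPoint IsPoly.coord fun n => ?_)
    simp only [Finset.sum_apply, Pi.smul_apply, smul_eq_mul, Function.curry]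
    exact IsPoly.sum _ fun l => (IsPoly.const _).mul (IsPoly.coord _)
  refine ⟨R, ?_, fun A hA => ?_⟩
  · rintro rfl
    exact h₀ (by simpa using hR A₀)
  · by_contra hRA
    have hg : IsPoly fun p : Fin N → ℝ => eval (Sum.elim A fun k :
        {k : Fin N // (k : ℕ) < M} => p k.1) Q := by
      refine IsPoly.eval_comp Q ?_
      rintro (q | k)
      · exact IsPoly.const _
      · exact IsPoly.coord _
    have hmem : ∑ l : S, a₀ l • Function.curry A l ∈ L (Function.curry A) S :=
      Submodule.sum_mem _ fun l _ => Submodule.smul_mem _ (a₀ l)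
        (Submodule.subset_span ⟨l, l.2, rfl⟩)
    exact hA ⟨_, hg, fun x hx => hQW (specPoint M A x) hx, _, hmem,
      fun h => hRA ((hR A).symm.trans h)⟩

theorem thin_not_SR1g {M : ℕ} (hM : M ≤ N / 2) :
    Thin {A : Fin N × Fin N → ℝ | ¬ SR1g (Function.curry A) M} := by
  refine Thin.mono (Thin.iUnion (ι := {S : Finset (Fin N) // S.card = M})
    fun S => thin_not_separated hM S.2 (thin_collisions hM S.2 S.2)) ?_
  intro A hA
  by_contra hcon
  refine hA fun S hS => ?_
  obtain ⟨g, hg, hgW, x₀, hx₀, hgx₀⟩ :=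
    not_not.1 fun h => hcon (Set.mem_iUnion.2 ⟨⟨S, hS⟩, h⟩)
  obtain ⟨p, hp⟩ := hg
  refine ⟨{x | g (powerSpectrum x) = 0}, isRealAlgebraic_of_isPoly ?_, ⟨x₀, hx₀, hgx₀⟩, ?_⟩
  · simp only [hp]
    exact IsPoly.eval_comp p fun k => isPoly_powerSpectrum k IsPoly.coord
  · rintro x ⟨hx, hgx⟩ y hy
    refine ⟨fun h => by_contra fun hxy => hgx ?_, powerSpectrum_eq_of_eqUpToSign⟩
    exact hgW x ⟨A, x, hx, y, hy, h, hxy, rfl⟩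

theorem mem_L_inter {V : Fin N → Fin N → ℝ} (hV : LinearIndependent ℝ V)
    {S₁ S₂ : Finset (Fin N)} {x : Fin N → ℝ} (h₁ : x ∈ L V S₁) (h₂ : x ∈ L V S₂) :
    x ∈ L V (S₁ ∩ S₂) := by
  obtain ⟨a, ha, rfl⟩ := exists_coeff_of_mem_L h₁
  obtain ⟨b, hb, hab⟩ := exists_coeff_of_mem_L h₂
  refine sum_smul_mem_L fun l hl => ?_
  by_cases hl₁ : l ∈ S₁
  · rw [Fintype.linearIndependent_iffₛ.1 hV a b hab l]
    exact hb l fun hl₂ => hl (Finset.mem_inter.2 ⟨hl₁, hl₂⟩)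
  · exact ha l hl₁

theorem thin_not_SR2g {M : ℕ} (hM : M ≤ N / 2) :
    Thin {A : Fin N × Fin N → ℝ | A ∈ bases N ∧ ¬ SR2g (Function.curry A) M} := by
  have hcard : ∀ {S₁ S₂ : Finset (Fin N)}, S₁.card = M → S₂.card = M → S₁ ≠ S₂ →
      (S₁ ∩ S₂).card < M := by
    intro S₁ S₂ h₁ h₂ hne
    refine lt_of_le_of_ne (h₁ ▸ Finset.card_le_card Finset.inter_subset_left) fun h => hne ?_
    have h₃ := Finset.eq_of_subset_of_card_le (Finset.inter_subset_left (s₁ := S₁) (s₂ := S₂))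
      (by omega)
    have h₄ := Finset.eq_of_subset_of_card_le (Finset.inter_subset_right (s₁ := S₁) (s₂ := S₂))
      (by omega)
    rw [← h₃, h₄]
  refine Thin.mono (Thin.iUnion (ι := {q : Finset (Fin N) × Finset (Fin N) //
    q.1.card = M ∧ q.2.card = M ∧ q.1 ≠ q.2})
    fun q => thin_not_separated hM q.2.1 ((thin_collisions hM q.2.1 q.2.2.1).union
      (thin_smallSupport (by omega) (hcard q.2.1 q.2.2.1 q.2.2.2)))) ?_
  rintro A ⟨hA, hSR⟩
  by_contra hcon
  refine hSR fun S₁ S₂ hS₁ hS₂ hne => ?_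
  obtain ⟨g, hg, hgW, x₀, hx₀, hgx₀⟩ :=
    not_not.1 fun h => hcon (Set.mem_iUnion.2 ⟨⟨⟨S₁, S₂⟩, hS₁, hS₂, hne⟩, h⟩)
  refine ⟨{p | g p = 0}, isRealAlgebraic_of_isPoly hg, ?_, Set.inter_subset_left, fun h =>
    hgx₀ (h ⟨x₀, hx₀, rfl⟩).2⟩
  rintro _ ⟨⟨x, hx, rfl⟩, ⟨y, hy, hyx⟩⟩
  refine ⟨⟨x, hx, rfl⟩, hgW x ?_⟩
  -- Linear independence puts a vector common to both subspaces into the span of the intersection of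
  -- the supports.
  by_cases hxy : EqUpToSign x y
  · obtain ⟨t, -, ht⟩ := hxy
    exact Or.inr ⟨A, x, mem_L_inter hA.1 hx (ht ▸ Submodule.smul_mem _ t hy), rfl⟩
  · exact Or.inl ⟨A, x, hx, y, hy, hyx.symm, hxy, rfl⟩

end SparsePhase

/-! ### Assembly -/

theorem mainTheorem1 (N : ℕ) :
    SparsePhase.ForGenericBasis N fun V => ∀ M : ℕ,
      ((Even N ∧ (N : ℤ) > 4 * (M : ℤ) - 6 ∨ Odd N ∧ (N : ℤ) > 4 * (M : ℤ) - 5) →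
        SparsePhase.SR1 V M) ∧
      ((Even N ∧ (N : ℤ) > 4 * (M : ℤ) - 4 ∨ Odd N ∧ (N : ℤ) > 4 * (M : ℤ) - 3) →
        SparsePhase.SR2 V M) ∧
      ((Even N ∧ (N : ℤ) > 2 * (M : ℤ) - 2 ∨ Odd N ∧ (N : ℤ) > 2 * (M : ℤ) - 1) →
        SparsePhase.SR1g V M ∧ SparsePhase.SR2g V M) := by
  open SparsePhase in
  -- The even and odd hypotheses are one inequality in terms of `N / 2`; the three conditions take
  -- `c = 4M - 4`, `4M - 2` and `2M`.
  have bound : ∀ {a b c : ℤ}, (Even N ∧ (N : ℤ) > a ∨ Odd N ∧ (N : ℤ) > b) →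
      a = c - 2 → b = c - 1 → c ≤ 2 * ((N / 2 : ℕ) : ℤ) + 1 := by
    rintro a b c (⟨⟨r, rfl⟩, h⟩ | ⟨⟨r, rfl⟩, h⟩) ha hb <;> omega
  -- One exceptional set must serve all `M`. The numerical conditions force `M < N + 2`, so the
  -- union is finite.
  refine forGenericBasis_of_thin (Thin.mono (Thin.iUnion (ι := Fin (N + 2)) (Z := fun M =>
    ({A | 2 * (M : ℕ) ≤ N / 2 + 2 ∧ ¬ SR1 (Function.curry A) M} ∪
      {A | 2 * (M : ℕ) ≤ N / 2 + 1 ∧ ¬ SR2 (Function.curry A) M}) ∪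
    ({A | (M : ℕ) ≤ N / 2 ∧ ¬ SR1g (Function.curry A) M} ∪
      {A | (M : ℕ) ≤ N / 2 ∧ A ∈ bases N ∧ ¬ SR2g (Function.curry A) M})) ?_) ?_)
  · have aux : ∀ {c : Prop} {p : (Fin N × Fin N → ℝ) → Prop}, (c → Thin {A | p A}) →
        Thin {A | c ∧ p A} := by
      intro c p h
      by_cases hc : c
      · exact (h hc).mono fun _ hA => hA.2
      · exact ⟨1, one_ne_zero, fun _ hA => absurd hA.1 hc⟩
    exact fun M => ((aux thin_not_SR1).union (aux thin_not_SR2)).union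
      ((aux thin_not_SR1g).union (aux thin_not_SR2g))
  · rintro A ⟨hA, hneg⟩
    by_contra hcon
    simp only [Set.mem_iUnion, Set.mem_union, Set.mem_ofPred_eq, not_exists, not_or, not_and,
      not_not] at hcon
    refine hneg fun M => ⟨fun h => ?_, fun h => ?_, fun h => ?_⟩
    · have := bound (c := 4 * (M : ℤ) - 4) h (by ring) (by ring)
      exact (hcon ⟨M, by omega⟩).1.1 (by simp only; omega)
    · have := bound (c := 4 * (M : ℤ) - 2) h (by ring) (by ring)
      exact (hcon ⟨M, by omega⟩).1.2 (by simp only; omega)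
    · have := bound (c := 2 * (M : ℤ)) h (by ring) (by ring)
      exact ⟨(hcon ⟨M, by omega⟩).2.1 (by simp only; omega),
        (hcon ⟨M, by omega⟩).2.2 (by simp only; omega) hA⟩
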